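/- **Theorem 1.3.** Let $A$ be a commutative ring with unit, let $n \ge 6$ be an integer, and let $\Gamma = EL_n(A)$ be the elementary linear group, i.e. the group generated by the elementary matrices $I_n + cE_{ij}$ ($i \ne j$, $c \in A$). Suppose that: 1. $EL_2(A) = SL_2(A)$; 2. $\Gamma$ is boundedly generated by $F_1 = SL_2(A)$, regarded as the subgroup of $\Gamma$ in the left upper corner (which is contained in $\Gamma$ by condition 1), and the set $F_2 = \{\, ghg^{-1}h^{-1} : g,h \in \Gamma \,\}$ of all single commutators in $\Gamma$; that is, there are $M \in \mathbb{N}$ and $i(1),\dots,i(M) \in \{1,2\}$ such that $\Gamma = F_{i(1)}F_{i(2)}\cdots F_{i(M)}$. Then every quasi-homomorphism on $\Gamma$ is bounded: if $\psi\colon \Gamma \to \mathbb{R}$ satisfies $\sup_{g,h\in\Gamma} |\psi(gh)-\psi(g)-\psi(h)| < \infty$, then $\sup_{g \in \Gamma} |\psi(g)| < \infty$. Equivalently, the stable commutator length vanishes on $\Gamma$. In particular both statements hold: $\Gamma = [\Gamma,\Gamma]$ and, for every $g \in \Gamma$, $$\mathrm{scl}(g) = \lim_{m\to\infty} \frac{\mathrm{cl}(g^m)}{m}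 = 0,$$ where $\mathrm{cl}(x)$ is the least number of commutators in $\Gamma$ whose product is $x$ (and $\mathrm{cl}(e_\Gamma) = 0$). -/

import Mathlib

open scoped Pointwise

/-! ### Quasi-homomorphisms -/

/-- `ψ : Γ → ℝ` is a quasi-homomorphism: the defect
`sup_{g, h} |ψ (g h) - ψ g - ψ h|` is finite. -/
def IsQuasiHom {Γ : Type*} [Group Γ] (ψ : Γ → ℝ) : Prop :=
  ∃ D : ℝ, ∀ g h : Γ, |ψ (g * h) - ψ g - ψ h| ≤ D

/-! ### Commutator length and stable commutator length -/

/-- The commutator length of `g`: the least `k` such that `g` is a product of `k` commutators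
(so the identity has commutator length `0`). It is meaningful for `g` in the commutator
subgroup; outside it the set is empty and the value is the default `0`. -/
noncomputable def commutatorLength {Γ : Type*} [Group Γ] (g : Γ) : ℕ :=
  sInf {k : ℕ | ∃ l : List Γ, l.length = k ∧ (∀ x ∈ l, x ∈ commutatorSet Γ) ∧ l.prod = g}

/-- The stable commutator length of `g` is defined and equal to `L`: the element `g` lies in the
commutator subgroup, and `cl (g ^ m) / m` converges to `L` as `m → ∞`. -/
def HasStableCommutatorLength {Γ : Type*} [Group Γ] (g : Γ) (L : ℝ) : Prop :=
  g ∈ commutator Γ ∧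
    Filter.Tendsto (fun m : ℕ => (commutatorLength (g ^ m) : ℝ) / (m : ℝ))
      Filter.atTop (nhds L)

/-! ### Bounded generation -/

/-- The finite family `F 1, …, F j` of subsets boundedly generates `Γ`: there are `M` and indices
`i(1), …, i(M)` with `Γ = F_{i(1)} ⋯ F_{i(M)}` (product of sets). -/
def BoundedlyGenerates {Γ : Type*} [Group Γ] {j : ℕ} (F : Fin j → Set Γ) : Prop :=
  ∃ (M : ℕ) (i : Fin M → Fin j), (List.ofFn fun m : Fin M => F (i m)).prod = Set.univ

/-! ### Elementary linear groups -/

/-- The elementary linear group `EL_n(A)`, generated by the elementary matrices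
`1 + c E_{ij}`, `i ≠ j`, as a subgroup of `SL_n(A)`. -/
def elementaryLinearGroup (n : ℕ) (A : Type*) [CommRing A] :
    Subgroup (Matrix.SpecialLinearGroup (Fin n) A) :=
  Subgroup.closure
    {g | ∃ (i j : Fin n) (hij : i ≠ j) (c : A),
      g = Matrix.SpecialLinearGroup.transvection hij c}

/-- The `n × n` matrix with the `2 × 2` matrix `s` in the left upper corner, ones on the rest of
the diagonal, and zeros elsewhere. -/
def cornerMatrix {A : Type*} [CommRing A] (n : ℕ) (s : Matrix (Fin 2) (Fin 2) A) :
    Matrix (Fin n) (Fin n) A :=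
  fun i j =>
    if h : (i : ℕ) < 2 ∧ (j : ℕ) < 2 then s ⟨i, h.1⟩ ⟨j, h.2⟩ else if i = j then 1 else 0

/-- The copy of `SL_2(A)` in the left upper corner, as a subset of `EL_n(A)`. When
`EL_2(A) = SL_2(A)` and `n ≥ 2`, every `s ∈ SL_2(A)` gives an element of it. -/
def cornerSL2 (n : ℕ) (A : Type*) [CommRing A] : Set (elementaryLinearGroup n A) :=
  {g | ∃ s : Matrix.SpecialLinearGroup (Fin 2) A,
    ((g : Matrix.SpecialLinearGroup (Fin n) A) : Matrix (Fin n) (Fin n) A) =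
      cornerMatrix n (s : Matrix (Fin 2) (Fin 2) A)}

/-!
The commutator length `cl` is a conjugation-invariant norm on the perfect group `Γ = EL_n(A)`.
Divide the group of sequences in `Γ` by the normal subgroup of sequences `x` with `cl (x m) = o(m)`.
Termwise commutators have length at most `1`, so the quotient is abelian. The class `p g` of
the sequence `g ^ m` is trivial exactly when `scl g = 0`, and `p` has the formal properties of a
homogeneous quasi-homomorphism: it is conjugation invariant, additive on commuting pairs, and
`p (g * k) = p g` when `k` lies in a subgroup normalized by `g` on which `cl` is bounded
(`powerClass_mul_of_bounded`).

For `s` in `SL_2(A)` let `φ s = p (diag(s, 1))`. Block upper triangular matrices with diagonal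
blocks `s` and `t` have class `φ s * φ t`, since unipotent blocks are products of four elementary
matrices, which are commutators. Conjugating by a lower unipotent block `X` preserves
triangularity when `t * X = X * (s + B * X)`, and gives
`φ s * φ t = φ (s + B * X) * φ (t - X * B)`. A Cayley-Hamilton argument (`exists_intertwiner`)
produces `X` and `B` for which this reads
`φ s * φ (C (tr (s * e))) = φ (s * e) * φ (C (tr s))`, where `e` is any elementary matrix and `C τ`
is the companion matrix of trace `τ`. Elementary matrices generate `SL_2(A)`, so
`φ s = φ (C (tr s))` depends on the trace only. As `s` and `s⁻¹` have the same trace,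
`φ s = (φ s)⁻¹`, hence `scl (s ^ 2) = 0` and `scl s = 0`
(`sclOfPerfect_eq_zero_of_mem_cornerSL2`).

Finally `scl (g * h) ≤ scl g + scl h + 1`, so bounded generation by the corner and the commutators
bounds `scl` on all of `Γ`, and a bounded `scl` vanishes by homogeneity. The vanishing of
`scl` bounds every quasi-homomorphism (`IsQuasiHom.bounded_of_scl_eq_zero`). The block argument
only needs room for two `2 × 2` blocks.
-/

open scoped commutatorElement

/-! ### Commutator length in a perfect group -/

section CommutatorLength

variable {Γ : Type*} [Group Γ]

theorem commutatorLength_le {g : Γ} (l : List Γ) (hl : ∀ x ∈ l, x ∈ commutatorSet Γ)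
    (hg : l.prod = g) : commutatorLength g ≤ l.length :=
  Nat.sInf_le ⟨l, rfl, hl, hg⟩

theorem inv_mem_commutatorSet {g : Γ} (hg : g ∈ commutatorSet Γ) : g⁻¹ ∈ commutatorSet Γ := by
  obtain ⟨a, b, rfl⟩ := hg
  exact ⟨b, a, (commutatorElement_inv a b).symm⟩

theorem conj_mem_commutatorSet (h : Γ) {g : Γ} (hg : g ∈ commutatorSet Γ) :
    h * g * h⁻¹ ∈ commutatorSet Γ := by
  obtain ⟨a, b, rfl⟩ := hg
  exact ⟨h * a * h⁻¹, h * b * h⁻¹, (conjugate_commutatorElement a b h).symm⟩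

theorem exists_list_length_eq_commutatorLength {g : Γ} (hg : g ∈ commutator Γ) :
    ∃ l : List Γ, l.length = commutatorLength g ∧ (∀ x ∈ l, x ∈ commutatorSet Γ) ∧
      l.prod = g := by
  have hne : {k : ℕ | ∃ l : List Γ, l.length = k ∧ (∀ x ∈ l, x ∈ commutatorSet Γ) ∧
      l.prod = g}.Nonempty := by
    rw [commutator_eq_closure, ← Subgroup.mem_toSubmonoid, Subgroup.closure_toSubmonoid] at hg
    obtain ⟨l, hl, hp⟩ := Submonoid.exists_list_of_mem_closure hg
    refine ⟨l.length, l, rfl, fun x hx => ?_, hp⟩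
    rcases hl x hx with h | h
    · exact h
    · simpa using inv_mem_commutatorSet (Set.mem_inv.1 h)
  exact Nat.sInf_mem hne

theorem commutatorLength_one : commutatorLength (1 : Γ) = 0 :=
  Nat.le_zero.1 (commutatorLength_le [] (by simp) rfl)

theorem commutatorLength_le_one {g : Γ} (hg : g ∈ commutatorSet Γ) : commutatorLength g ≤ 1 :=
  commutatorLength_le [g] (by simpa using hg) (by simp)

variable (hΓ : commutator Γ = ⊤)
include hΓ

theorem commutatorLength_mul_le (g h : Γ) :
    commutatorLength (g * h) ≤ commutatorLength g + commutatorLength h := by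
  obtain ⟨l, hl, hlc, hlp⟩ := exists_list_length_eq_commutatorLength (g := g) (by simp [hΓ])
  obtain ⟨k, hk, hkc, hkp⟩ := exists_list_length_eq_commutatorLength (g := h) (by simp [hΓ])
  rw [← hl, ← hk, ← List.length_append]
  refine commutatorLength_le _ (fun x hx => ?_) (by simp [hlp, hkp])
  rcases List.mem_append.1 hx with hx | hx
  exacts [hlc x hx, hkc x hx]

theorem commutatorLength_inv_le (g : Γ) : commutatorLength g⁻¹ ≤ commutatorLength g := by
  obtain ⟨l, hl, hlc, hlp⟩ := exists_list_length_eq_commutatorLength (g := g) (by simp [hΓ])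
  rw [← hl, ← hlp, List.prod_inv_reverse]
  refine (commutatorLength_le _ (fun x hx => ?_) rfl).trans (by simp)
  simp only [List.mem_reverse, List.mem_map] at hx
  obtain ⟨y, hy, rfl⟩ := hx
  exact inv_mem_commutatorSet (hlc y hy)

theorem commutatorLength_conj_le (h g : Γ) :
    commutatorLength (h * g * h⁻¹) ≤ commutatorLength g := by
  obtain ⟨l, hl, hlc, hlp⟩ := exists_list_length_eq_commutatorLength (g := g) (by simp [hΓ])
  rw [← hl]
  refine (commutatorLength_le (l.map (MulAut.conj h)) (fun x hx => ?_) ?_).trans (by simp)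
  · obtain ⟨y, hy, rfl⟩ := List.mem_map.1 hx
    exact conj_mem_commutatorSet h (hlc y hy)
  · rw [← map_list_prod, hlp, MulAut.conj_apply]

/-- In the abelianization `(g * h) ^ m` equals `g ^ m * h ^ m`; the two differ by at most `m`
commutators, since moving one factor `g` past a power of `h` costs one commutator. -/
theorem commutatorLength_mul_pow_le (g h : Γ) (m : ℕ) :
    commutatorLength ((g * h) ^ m) ≤
      commutatorLength (g ^ m) + commutatorLength (h ^ m) + m := by
  have key : ∀ m : ℕ, commutatorLength ((g * h) ^ m * (g ^ m * h ^ m)⁻¹) ≤ m := by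
    intro m
    induction m with
    | zero => simp [commutatorLength_one]
    | succ m ih =>
      have e : (g * h) ^ (m + 1) * (g ^ (m + 1) * h ^ (m + 1))⁻¹ =
          ((g * h) ^ m * (g ^ m * h ^ m)⁻¹) * (g ^ m * ⁅h ^ m, g⁆ * (g ^ m)⁻¹) := by
        rw [commutatorElement_def]; simp only [pow_succ]; group
      rw [e]
      exact (commutatorLength_mul_le hΓ _ _).trans (Nat.add_le_add ih
        (commutatorLength_le_one (conj_mem_commutatorSet _ (commutator_mem_commutatorSet _ _))))
  have e : (g * h) ^ m = ((g * h) ^ m * (g ^ m * h ^ m)⁻¹) * (g ^ m * h ^ m) := by group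
  rw [e]
  have h1 := commutatorLength_mul_le hΓ ((g * h) ^ m * (g ^ m * h ^ m)⁻¹) (g ^ m * h ^ m)
  have h2 := commutatorLength_mul_le hΓ (g ^ m) (h ^ m)
  have h3 := key m
  omega

theorem subadditive_commutatorLength_pow (g : Γ) :
    Subadditive fun m : ℕ => (commutatorLength (g ^ m) : ℝ) := by
  intro m k
  simp only [pow_add]
  exact_mod_cast commutatorLength_mul_le hΓ _ _

end CommutatorLength

/-! ### Stable commutator length in a perfect group -/

section Scl

open Filter Topology

variable {Γ : Type*} [Group Γ] (hΓ : commutator Γ = ⊤)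

/-- The stable commutator length of an element of a perfect group, as the limit provided by
Fekete's lemma. -/
noncomputable def sclOfPerfect (g : Γ) : ℝ :=
  (subadditive_commutatorLength_pow hΓ g).lim

theorem tendsto_sclOfPerfect (g : Γ) :
    Tendsto (fun m : ℕ => (commutatorLength (g ^ m) : ℝ) / m) atTop (𝓝 (sclOfPerfect hΓ g)) :=
  Subadditive.tendsto_lim _ ⟨0, by rintro _ ⟨m, rfl⟩; positivity⟩

theorem sclOfPerfect_nonneg (g : Γ) : 0 ≤ sclOfPerfect hΓ g :=
  ge_of_tendsto' (tendsto_sclOfPerfect hΓ g) fun _ => by positivity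

theorem sclOfPerfect_le_commutatorLength (g : Γ) :
    sclOfPerfect hΓ g ≤ commutatorLength g := by
  have h := (subadditive_commutatorLength_pow hΓ g).lim_le_div
    ⟨0, by rintro _ ⟨m, rfl⟩; positivity⟩ one_ne_zero
  simpa [sclOfPerfect] using h

theorem sclOfPerfect_mul_le (g h : Γ) :
    sclOfPerfect hΓ (g * h) ≤ sclOfPerfect hΓ g + sclOfPerfect hΓ h + 1 := by
  refine le_of_tendsto_of_tendsto (tendsto_sclOfPerfect hΓ (g * h))
    (((tendsto_sclOfPerfect hΓ g).add (tendsto_sclOfPerfect hΓ h)).add tendsto_const_nhds) ?_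
  filter_upwards [eventually_gt_atTop 0] with m hm
  have hm' : (0 : ℝ) < m := by exact_mod_cast hm
  rw [← add_div, div_add_one hm'.ne']
  gcongr
  exact_mod_cast commutatorLength_mul_pow_le hΓ g h m

theorem sclOfPerfect_pow (g : Γ) {k : ℕ} (hk : k ≠ 0) :
    sclOfPerfect hΓ (g ^ k) = k * sclOfPerfect hΓ g := by
  have h1 := ((tendsto_sclOfPerfect hΓ g).comp
    (tendsto_id.const_mul_atTop' (Nat.pos_of_ne_zero hk))).const_mul (k : ℝ)
  refine tendsto_nhds_unique (tendsto_sclOfPerfect hΓ (g ^ k)) (h1.congr fun m => ?_)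
  have hk' : (k : ℝ) ≠ 0 := by exact_mod_cast hk
  rcases eq_or_ne m 0 with rfl | hm
  · simp
  have hm' : (m : ℝ) ≠ 0 := by exact_mod_cast hm
  simp only [Function.comp_apply, id, pow_mul, Nat.cast_mul]
  field_simp

/-- On a product of `k` sets on each of which the stable commutator length is at most `1`, it is
at most `2 * k`. -/
theorem sclOfPerfect_le_of_mem_prod (l : List (Set Γ))
    (hl : ∀ F ∈ l, ∀ x ∈ F, sclOfPerfect hΓ x ≤ 1) :
    ∀ g ∈ l.prod, sclOfPerfect hΓ g ≤ 2 * l.length := by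
  induction l with
  | nil =>
    intro g hg
    obtain rfl : g = 1 := by simpa using hg
    simpa [commutatorLength_one] using sclOfPerfect_le_commutatorLength hΓ (1 : Γ)
  | cons F l ih =>
    intro g hg
    rw [List.prod_cons] at hg
    obtain ⟨x, hx, y, hy, rfl⟩ := Set.mem_mul.1 hg
    have h1 := hl F (by simp) x hx
    have h2 := ih (fun F' hF' => hl F' (by simp [hF'])) y hy
    have h3 := sclOfPerfect_mul_le hΓ x y
    push_cast [List.length_cons]
    linarith

/-- A bounded stable commutator length vanishes, because it is homogeneous. -/
theorem sclOfPerfect_eq_zero_of_bounded {C : ℝ} (hC : ∀ g : Γ, sclOfPerfect hΓ g ≤ C) (g : Γ) :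
    sclOfPerfect hΓ g = 0 := by
  refine le_antisymm (le_of_forall_pos_le_add fun ε hε => ?_) (sclOfPerfect_nonneg hΓ g)
  obtain ⟨k, hk⟩ := exists_nat_gt (C / ε)
  have h := hC (g ^ (k + 1))
  rw [sclOfPerfect_pow hΓ g k.succ_ne_zero] at h
  rw [div_lt_iff₀ hε] at hk
  push_cast at h
  by_contra! hlt
  nlinarith [(Nat.cast_nonneg k : (0 : ℝ) ≤ k)]

end Scl

/-! ### Quasi-homomorphisms and stable commutator length -/

section QuasiHom

open Filter Topology

variable {Γ : Type*} [Group Γ]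

theorem IsQuasiHom.exists_bound_commutatorLength (hΓ : commutator Γ = ⊤) {ψ : Γ → ℝ}
    (hψ : IsQuasiHom ψ) : ∃ C : ℝ, ∀ g : Γ, |ψ g| ≤ C * (commutatorLength g + 1) := by
  obtain ⟨D, hD⟩ := hψ
  have hD0 : 0 ≤ D := (abs_nonneg _).trans (hD 1 1)
  have h1 : |ψ 1| ≤ D := by simpa using hD 1 1
  have hc : ∀ x ∈ commutatorSet Γ, |ψ x| ≤ 3 * D := by
    rintro _ ⟨a, b, rfl⟩
    have e : ⁅a, b⁆ * (b * a) = a * b := by rw [commutatorElement_def]; group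
    have h2 := abs_le.1 (hD ⁅a, b⁆ (b * a))
    have h3 := abs_le.1 (hD a b)
    have h4 := abs_le.1 (hD b a)
    rw [e] at h2
    rw [abs_le]
    constructor <;> linarith [h2.1, h2.2, h3.1, h3.2, h4.1, h4.2]
  have hl : ∀ l : List Γ, (∀ x ∈ l, x ∈ commutatorSet Γ) →
      |ψ l.prod| ≤ 4 * D * (l.length + 1) := by
    intro l
    induction l with
    | nil => intro _; simp only [List.prod_nil, List.length_nil]; push_cast; linarith
    | cons x l ih =>
      intro hx
      have h2 := abs_le.1 (ih fun y hy => hx y (by simp [hy]))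
      have h3 := abs_le.1 (hc x (hx x (by simp)))
      have h4 := abs_le.1 (hD x l.prod)
      rw [List.prod_cons, List.length_cons, abs_le]
      push_cast
      constructor <;> nlinarith [h2.1, h2.2, h3.1, h3.2, h4.1, h4.2]
  refine ⟨4 * D, fun g => ?_⟩
  obtain ⟨l, hlen, hlc, rfl⟩ := exists_list_length_eq_commutatorLength (g := g) (by simp [hΓ])
  rw [← hlen]
  exact hl l hlc

/-- The elementary half of Bavard's duality: `ψ (g ^ m)` is within `m * D` of `m * ψ g` and is
`O(cl (g ^ m))`, so `|ψ g| ≤ D` when `cl (g ^ m) = o(m)`. -/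
theorem IsQuasiHom.bounded_of_scl_eq_zero (hΓ : commutator Γ = ⊤)
    (hscl : ∀ g : Γ, sclOfPerfect hΓ g = 0) {ψ : Γ → ℝ} (hψ : IsQuasiHom ψ) :
    ∃ C : ℝ, ∀ g : Γ, |ψ g| ≤ C := by
  obtain ⟨C, hC⟩ := hψ.exists_bound_commutatorLength hΓ
  obtain ⟨D, hD⟩ := hψ
  have h1 : |ψ 1| ≤ D := by simpa using hD 1 1
  refine ⟨D, fun g => ?_⟩
  have hpow : ∀ m : ℕ, |ψ (g ^ m) - m * ψ g| ≤ (m + 1) * D := by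
    intro m
    induction m with
    | zero => simpa using h1
    | succ m ih =>
      have h2 := abs_le.1 ih
      have h3 := abs_le.1 (hD (g ^ m) g)
      rw [pow_succ, abs_le]
      push_cast
      constructor <;> linarith [h2.1, h2.2, h3.1, h3.2]
  have hlim : Tendsto (fun m : ℕ => (1 + 1 / (m : ℝ)) * D +
      C * ((commutatorLength (g ^ m) : ℝ) / m + 1 / (m : ℝ))) atTop (𝓝 D) := by
    have h2 := tendsto_sclOfPerfect hΓ g
    rw [hscl g] at h2
    have h3 := tendsto_one_div_atTop_nhds_zero_nat (𝕜 := ℝ)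
    simpa using ((h3.const_add 1).mul_const D).add ((h2.add h3).const_mul C)
  refine ge_of_tendsto hlim ?_
  filter_upwards [eventually_gt_atTop 0] with m hm
  have hm' : (0 : ℝ) < m := by exact_mod_cast hm
  have e : (1 + 1 / (m : ℝ)) * D + C * ((commutatorLength (g ^ m) : ℝ) / m + 1 / (m : ℝ)) =
      ((m + 1) * D + C * (commutatorLength (g ^ m) + 1)) / m := by field_simp
  rw [e, le_div_iff₀ hm']
  have h2 : |ψ g| * m = |m * ψ g| := by rw [abs_mul, abs_of_pos hm', mul_comm]
  rw [h2]
  calc |m * ψ g| = |ψ (g ^ m) - (ψ (g ^ m) - m * ψ g)| := by congr 1; ring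
    _ ≤ |ψ (g ^ m)| + |ψ (g ^ m) - m * ψ g| := abs_sub _ _
    _ ≤ _ := by linarith [hC (g ^ m), hpow m]

end QuasiHom

/-! ### Sequences modulo sublinear commutator length -/

section PowerClass

open Filter Topology

variable {Γ : Type*} [Group Γ] (hΓ : commutator Γ = ⊤)

/-- The sequences in a perfect group whose commutator length grows sublinearly. -/
def sublinearSeq : Subgroup (ℕ → Γ) where
  carrier := {x | Tendsto (fun m : ℕ => (commutatorLength (x m) : ℝ) / m) atTop (𝓝 0)}
  one_mem' := by simp [commutatorLength_one]
  mul_mem' {x y} hx hy := by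
    have h := Tendsto.add hx hy
    rw [add_zero] at h
    refine squeeze_zero (fun _ => by positivity) (fun m => ?_) h
    rw [← add_div]
    gcongr
    exact_mod_cast commutatorLength_mul_le hΓ (x m) (y m)
  inv_mem' {x} hx := by
    refine squeeze_zero (fun _ => by positivity) (fun m => ?_) hx
    gcongr
    exact commutatorLength_inv_le hΓ (x m)

theorem mem_sublinearSeq_of_bounded {x : ℕ → Γ} (C : ℕ) (hx : ∀ m, commutatorLength (x m) ≤ C) :
    x ∈ sublinearSeq hΓ := by
  refine squeeze_zero (fun _ => by positivity) (fun m => ?_)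
    (tendsto_const_div_atTop_nhds_zero_nat (C : ℝ))
  gcongr
  exact hx m

instance sublinearSeq_normal : (sublinearSeq hΓ).Normal where
  conj_mem x hx y := by
    refine squeeze_zero (fun _ => by positivity) (fun m => ?_) hx
    gcongr
    exact commutatorLength_conj_le hΓ (y m) (x m)

/-- Sequences in a perfect group modulo those of sublinear commutator length. Termwise commutators
have commutator length at most `1`, so this quotient is abelian. -/
abbrev AsymptoticClass : Type _ := (ℕ → Γ) ⧸ sublinearSeq hΓ

instance asymptoticClass_commGroup : CommGroup (AsymptoticClass hΓ) where
  mul_comm a b := by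
    induction a using QuotientGroup.induction_on with | _ x
    induction b using QuotientGroup.induction_on with | _ y
    rw [← QuotientGroup.mk_mul, ← QuotientGroup.mk_mul, QuotientGroup.eq]
    refine mem_sublinearSeq_of_bounded hΓ 1 fun m => commutatorLength_le_one ?_
    refine ⟨(y m)⁻¹, (x m)⁻¹, ?_⟩
    simp [commutatorElement_def, mul_assoc]

/-- The class of the sequence of powers of `g`; it is trivial exactly when `scl g = 0`. It behaves
like a homogeneous quasi-homomorphism with values in an abelian group. -/
def powerClass (g : Γ) : AsymptoticClass hΓ := QuotientGroup.mk fun m => g ^ m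

theorem powerClass_conj (h g : Γ) : powerClass hΓ (h * g * h⁻¹) = powerClass hΓ g := by
  have e : (fun m : ℕ => (h * g * h⁻¹) ^ m) = (fun _ => h) * (fun m => g ^ m) * (fun _ => h)⁻¹ := by
    ext m; simp [conj_pow]
  rw [powerClass, e, QuotientGroup.mk_mul, QuotientGroup.mk_mul, QuotientGroup.mk_inv,
    mul_inv_cancel_comm, powerClass]

theorem powerClass_mul_of_commute {g h : Γ} (H : Commute g h) :
    powerClass hΓ (g * h) = powerClass hΓ g * powerClass hΓ h := by
  rw [powerClass, powerClass, powerClass, ← QuotientGroup.mk_mul]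
  congr 1
  ext m
  exact H.mul_pow m

theorem powerClass_one : powerClass hΓ 1 = 1 := by
  have e : (fun m : ℕ => (1 : Γ) ^ m) = 1 := by ext; simp
  rw [powerClass, e, QuotientGroup.mk_one]

theorem powerClass_inv (g : Γ) : powerClass hΓ g⁻¹ = (powerClass hΓ g)⁻¹ := by
  rw [eq_inv_iff_mul_eq_one, ← powerClass_mul_of_commute hΓ (Commute.refl g).inv_left,
    inv_mul_cancel, powerClass_one]

/-- If `g` conjugates `K` into itself and the commutator length is bounded on `K`, then the powers
of `g * k` and of `g` differ by elements of `K`. -/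
theorem powerClass_mul_of_bounded (K : Subgroup Γ) (C : ℕ)
    (hC : ∀ k ∈ K, commutatorLength k ≤ C) {g : Γ} (hg : ∀ k ∈ K, g * k * g⁻¹ ∈ K) {k : Γ}
    (hk : k ∈ K) : powerClass hΓ (g * k) = powerClass hΓ g := by
  have key : ∀ m : ℕ, (g * k) ^ m * (g ^ m)⁻¹ ∈ K := by
    intro m
    induction m with
    | zero => simp
    | succ m ih =>
      have e : (g * k) ^ (m + 1) * (g ^ (m + 1))⁻¹ =
          g * (k * ((g * k) ^ m * (g ^ m)⁻¹)) * g⁻¹ := by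
        rw [pow_succ', pow_succ']; group
      rw [e]
      exact hg _ (K.mul_mem hk ih)
  symm
  rw [powerClass, powerClass, QuotientGroup.eq, (sublinearSeq_normal hΓ).mem_comm_iff]
  exact mem_sublinearSeq_of_bounded hΓ C fun m => hC _ (key m)

theorem sclOfPerfect_eq_zero_of_powerClass {g : Γ} (hg : powerClass hΓ g = 1) :
    sclOfPerfect hΓ g = 0 :=
  tendsto_nhds_unique (tendsto_sclOfPerfect hΓ g) ((QuotientGroup.eq_one_iff _).1 hg)

end PowerClass

/-! ### Traces in `SL_2` -/

section TwoByTwo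

open Matrix

variable {A : Type*} [CommRing A]

/-- The companion matrix of `x ^ 2 - τ * x + 1`, as an element of `SL_2(A)`. -/
def companionSL2 (τ : A) : Matrix.SpecialLinearGroup (Fin 2) A :=
  ⟨!![0, 1; -1, τ], by simp [det_fin_two]⟩

theorem trace_companionSL2 (τ : A) :
    trace (companionSL2 τ : Matrix (Fin 2) (Fin 2) A) = τ := by
  simp [companionSL2, trace_fin_two]

theorem coe_conj_companionSL2 (p τ : A) :
    ((Matrix.SpecialLinearGroup.transvection (one_ne_zero : (1 : Fin 2) ≠ 0) p * companionSL2 τ *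
      (Matrix.SpecialLinearGroup.transvection (one_ne_zero : (1 : Fin 2) ≠ 0) p)⁻¹ :
      Matrix.SpecialLinearGroup (Fin 2) A) : Matrix (Fin 2) (Fin 2) A) =
      !![-p, 1; -1 - p * (p + τ), p + τ] := by
  rw [Matrix.SpecialLinearGroup.coe_mul, Matrix.SpecialLinearGroup.coe_mul,
    Matrix.SpecialLinearGroup.transvection_inv, Matrix.SpecialLinearGroup.transvection_coe,
    Matrix.SpecialLinearGroup.transvection_coe, ← Matrix.ext_iff]
  simp [Fin.forall_fin_two, companionSL2, mul_apply, Fin.sum_univ_two, Matrix.single_apply,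
    Matrix.one_apply]
  ring

/-- The matrix identity behind the reduction to traces. Put `e = 1 + c E_{ij}`, `s' = s * e` and
`t = companion (trace s')`. Let `X` have as rows the `j`-th rows of `1` and of `s'`, so that
`t * X = X * s'` by the Cayley-Hamilton theorem. The rank-one perturbation `s' - s = c s E_{ij}`
factors through the `j`-th coordinate, hence as `B * X`, and the correction `t - X * B` on the
other side is conjugate to `companion (trace s)`. -/
theorem exists_intertwiner (s : Matrix.SpecialLinearGroup (Fin 2) A) {i j : Fin 2} (hij : i ≠ j)
    (c : A) : ∃ (X B : Matrix (Fin 2) (Fin 2) A) (h : Matrix.SpecialLinearGroup (Fin 2) A),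
      (companionSL2 (trace ((s * Matrix.SpecialLinearGroup.transvection hij c :
            Matrix.SpecialLinearGroup (Fin 2) A) : Matrix (Fin 2) (Fin 2) A)) :
          Matrix (Fin 2) (Fin 2) A) * X =
        X * (s * Matrix.SpecialLinearGroup.transvection hij c : Matrix.SpecialLinearGroup (Fin 2) A) ∧
      ((s * Matrix.SpecialLinearGroup.transvection hij c : Matrix.SpecialLinearGroup (Fin 2) A) :
        Matrix (Fin 2) (Fin 2) A) = s + B * X ∧
      ((h * companionSL2 (trace (s : Matrix (Fin 2) (Fin 2) A)) * h⁻¹ :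
          Matrix.SpecialLinearGroup (Fin 2) A) : Matrix (Fin 2) (Fin 2) A) =
        companionSL2 (trace ((s * Matrix.SpecialLinearGroup.transvection hij c :
          Matrix.SpecialLinearGroup (Fin 2) A) : Matrix (Fin 2) (Fin 2) A)) - X * B := by
  have hd := s.det_coe
  rw [det_fin_two] at hd
  refine ⟨of ![Pi.single j 1,
      fun k => (s * Matrix.SpecialLinearGroup.transvection hij c :
        Matrix.SpecialLinearGroup (Fin 2) A) j k],
    of fun k => ![c * s k i, 0],
    Matrix.SpecialLinearGroup.transvection (one_ne_zero : (1 : Fin 2) ≠ 0) (c * s j i), ?_, ?_,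
    (coe_conj_companionSL2 _ _).trans ?_⟩
  all_goals
    rw [← Matrix.ext_iff]
    fin_cases i <;> fin_cases j <;> first | exact absurd rfl hij | skip
  all_goals
    simp [Fin.forall_fin_two, companionSL2, Matrix.SpecialLinearGroup.transvection_coe, mul_apply,
      Fin.sum_univ_two, trace_fin_two, vecMul, dotProduct,
      Matrix.single_apply, Matrix.one_apply]
  · constructor
    · ring
    · linear_combination hd
  · constructor
    · linear_combination hd
    · ring
  · constructor <;> ring
  · constructor <;> ring
  · constructor <;> ring
  · constructor <;> ring

section BlockArgument

variable {A Γ : Type*} [CommRing A] [Group Γ] (hΓ : commutator Γ = ⊤)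

/-- Let `D` embed pairs from `SL_2(A)` block-diagonally, let `u` and `l` stand for the upper and
lower unipotent block matrices, and let `φ s` be the power class of `diag(s, 1)`. The class of
`diag(s, t)` is `φ s * φ t`, so the intertwining of `exists_intertwiner` shows that
`φ s / φ (companion (trace s))` does not change when `s` is multiplied by an elementary matrix.
As these generate, `φ s` depends on `trace s` only; but `s` and `s⁻¹` have the same trace. -/
theorem powerClass_sq_eq_one_of_blocks (h_elem : elementaryLinearGroup 2 A = ⊤)
    (D : Matrix.SpecialLinearGroup (Fin 2) A × Matrix.SpecialLinearGroup (Fin 2) A →* Γ)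
    (u l : Matrix (Fin 2) (Fin 2) A → Γ)
    (hu : ∀ p B, powerClass hΓ (D p * u B) = powerClass hΓ (D p))
    (hswap : ∃ w, ∀ s t, w * D (s, t) * w⁻¹ = D (t, s))
    (hl : ∀ (s t s' t' : Matrix.SpecialLinearGroup (Fin 2) A) (X B : Matrix (Fin 2) (Fin 2) A),
      (t : Matrix (Fin 2) (Fin 2) A) * X = X * s' →
      (s' : Matrix (Fin 2) (Fin 2) A) = s + B * X →
      (t' : Matrix (Fin 2) (Fin 2) A) = t - X * B →
      ∃ B₁ B₂, l X * (D (s', t') * u B₁) * (l X)⁻¹ = D (s, t) * u B₂)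
    (s : Matrix.SpecialLinearGroup (Fin 2) A) : powerClass hΓ (D (s, 1)) ^ 2 = 1 := by
  set φ : Matrix.SpecialLinearGroup (Fin 2) A → AsymptoticClass hΓ :=
    fun s => powerClass hΓ (D (s, 1)) with hφ
  have hsplit : ∀ s t, powerClass hΓ (D (s, t)) = φ s * φ t := by
    intro s t
    obtain ⟨w, hw⟩ := hswap
    have hc : Commute (D (s, 1)) (D (1, t)) := by
      rw [commute_iff_eq, ← map_mul, ← map_mul]; simp
    have e : D (s, t) = D (s, 1) * D (1, t) := by rw [← map_mul]; simp
    rw [e, powerClass_mul_of_commute hΓ hc, ← hw t 1, powerClass_conj]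
  have hconj : ∀ h s, φ (h * s * h⁻¹) = φ s := by
    intro h s
    have e : D (h * s * h⁻¹, 1) = D (h, 1) * D (s, 1) * (D (h, 1))⁻¹ := by
      rw [← map_inv, ← map_mul, ← map_mul]; simp
    simp only [hφ, e, powerClass_conj]
  have hinv : ∀ s, φ s⁻¹ = (φ s)⁻¹ := by
    intro s
    have e : D (s⁻¹, 1) = (D (s, 1))⁻¹ := by rw [← map_inv]; simp
    simp only [hφ, e, powerClass_inv]
  set τ : Matrix.SpecialLinearGroup (Fin 2) A → A :=
    fun s => trace (s : Matrix (Fin 2) (Fin 2) A) with hτ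
  have hstep : ∀ e : Matrix.SpecialLinearGroup (Fin 2) A, ∀ s,
      φ (s * e) / φ (companionSL2 (τ (s * e))) = φ s / φ (companionSL2 (τ s)) := by
    intro e
    have he : e ∈ elementaryLinearGroup 2 A := by simp [h_elem]
    induction he using Subgroup.closure_induction with
    | mem e he =>
      obtain ⟨i, j, hij, c, rfl⟩ := he
      intro s
      obtain ⟨X, B, h, hX, hs, ht⟩ := exists_intertwiner s hij c
      obtain ⟨B₁, B₂, hB⟩ := hl _ _ _ _ X B hX hs ht
      have h1 := congrArg (powerClass hΓ) hB
      -- The two block-diagonal matrices `(s * e, h * companion (trace s) * h⁻¹)` and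
      -- `(s, companion (trace (s * e)))` have the same power class.
      rw [powerClass_conj, hu, hu, hsplit, hsplit, hconj] at h1
      rw [div_eq_div_iff_mul_eq_mul]
      exact h1
    | one => intro s; rw [mul_one]
    | mul x y _ _ hx hy => intro s; rw [← mul_assoc, hy, hx]
    | inv x _ hx =>
      intro s
      have := hx (s * x⁻¹)
      rw [inv_mul_cancel_right] at this
      exact this.symm
  have htr : ∀ s, φ s = φ (companionSL2 (τ s)) := by
    intro s
    have h1 := hstep s 1
    have h2 := hstep (companionSL2 (τ 1)) 1
    have h3 : τ (companionSL2 (τ 1)) = τ 1 := trace_companionSL2 _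
    rw [one_mul, h3, div_self'] at h2
    rw [one_mul, ← h2] at h1
    exact div_eq_one.1 h1
  have htinv : τ s⁻¹ = τ s := by
    simp [hτ, adjugate_fin_two, trace_fin_two, add_comm]
  have h1 : φ s⁻¹ = φ s := by rw [htr s⁻¹, htinv, ← htr]
  rw [hinv] at h1
  calc φ s ^ 2 = φ s * (φ s)⁻¹ := by rw [h1, sq]
    _ = 1 := mul_inv_cancel _

end BlockArgument

end TwoByTwo

/-! ### Stabilization, elementary matrices and block matrices -/

section Blocks

open Matrix

variable {A : Type*} [CommRing A]

section Embedding

variable {ι μ κ : Type*} [Fintype ι] [DecidableEq ι] [Fintype μ] [DecidableEq μ] [Fintype κ]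
  [DecidableEq κ]

/-- The stabilization `SL_ι(A) → SL_κ(A)`, `s ↦ diag(s, 1)`, along a splitting `ι ⊕ μ ≃ κ` of the
larger index type. -/
def stabilizeSL (e : ι ⊕ μ ≃ κ) :
    Matrix.SpecialLinearGroup ι A →* Matrix.SpecialLinearGroup κ A where
  toFun s := ⟨(fromBlocks (s : Matrix ι ι A) 0 0 1).submatrix e.symm e.symm, by
    rw [det_submatrix_equiv_self, det_fromBlocks_zero₂₁, s.det_coe, det_one, mul_one]⟩
  map_one' := by
    apply Subtype.ext
    simp [Matrix.SpecialLinearGroup.coe_one]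
  map_mul' s t := by
    apply Subtype.ext
    change _ = (fromBlocks (s : Matrix ι ι A) 0 0 1).submatrix e.symm e.symm *
      (fromBlocks (t : Matrix ι ι A) 0 0 1).submatrix e.symm e.symm
    simp [submatrix_mul_equiv, fromBlocks_multiply]

theorem coe_stabilizeSL (e : ι ⊕ μ ≃ κ) (s : Matrix.SpecialLinearGroup ι A) :
    (stabilizeSL e s : Matrix κ κ A) =
      (fromBlocks (s : Matrix ι ι A) 0 0 1).submatrix e.symm e.symm := rfl

theorem stabilizeSL_transvection (e : ι ⊕ μ ≃ κ) {i j : ι} (hij : i ≠ j)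
    (hij' : e (Sum.inl i) ≠ e (Sum.inl j)) (c : A) :
    stabilizeSL e (Matrix.SpecialLinearGroup.transvection hij c) =
      Matrix.SpecialLinearGroup.transvection hij' c := by
  apply Subtype.ext
  rw [coe_stabilizeSL, Matrix.SpecialLinearGroup.transvection_coe]
  change _ = ((Matrix.SpecialLinearGroup.transvection hij' c :
    Matrix.SpecialLinearGroup κ A) : Matrix κ κ A)
  rw [Matrix.SpecialLinearGroup.transvection_coe]
  ext a b
  obtain ⟨a, rfl⟩ := e.surjective a
  obtain ⟨b, rfl⟩ := e.surjective b
  rcases a with a | a <;> rcases b with b | b <;>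
    simp [Matrix.single_apply, Matrix.one_apply]

end Embedding

section Commutator

variable {ι : Type*} [Fintype ι] [DecidableEq ι]

/-- The relation `[1 + c E_{ik}, 1 + E_{kj}] = 1 + c E_{ij}`, without inverses. -/
theorem transvection_mul_transvection_eq {i j k : ι} (hij : i ≠ j) (hik : i ≠ k) (hkj : k ≠ j)
    (c : A) :
    Matrix.SpecialLinearGroup.transvection hik c * Matrix.SpecialLinearGroup.transvection hkj 1 =
      Matrix.SpecialLinearGroup.transvection hij c *
        (Matrix.SpecialLinearGroup.transvection hkj 1 *
          Matrix.SpecialLinearGroup.transvection hik c) := by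
  apply Subtype.ext
  simp only [Matrix.SpecialLinearGroup.coe_mul, Matrix.SpecialLinearGroup.transvection_coe]
  simp [mul_add, add_mul, single_mul_single_of_ne, hij.symm, hkj.symm]
  abel

end Commutator

section ElementaryLinearGroup

variable {n : ℕ}

theorem transvection_mem_elementaryLinearGroup {i j : Fin n} (hij : i ≠ j) (c : A) :
    Matrix.SpecialLinearGroup.transvection hij c ∈ elementaryLinearGroup n A :=
  Subgroup.subset_closure ⟨i, j, hij, c, rfl⟩

theorem transvection_mem_commutatorSet (hn : 3 ≤ n) {i j : Fin n} (hij : i ≠ j) (c : A) :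
    (⟨_, transvection_mem_elementaryLinearGroup hij c⟩ : elementaryLinearGroup n A) ∈
      commutatorSet (elementaryLinearGroup n A) := by
  obtain ⟨k, hk⟩ : ∃ k, k ∉ ({i, j} : Finset (Fin n)) :=
    Finset.exists_mem_notMem_of_card_lt_card (s := {i, j}) (t := Finset.univ)
      (Finset.card_le_two.trans_lt (by simpa [Nat.lt_iff_add_one_le] using hn)) |>.imp fun _ h => h.2
  simp only [Finset.mem_insert, Finset.mem_singleton, not_or] at hk
  refine ⟨⟨_, transvection_mem_elementaryLinearGroup (Ne.symm hk.1) c⟩,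
    ⟨_, transvection_mem_elementaryLinearGroup hk.2 1⟩, ?_⟩
  rw [commutatorElement_def, mul_assoc, ← _root_.mul_inv_rev, mul_inv_eq_iff_eq_mul]
  exact Subtype.ext (transvection_mul_transvection_eq hij (Ne.symm hk.1) hk.2 c)

theorem commutator_elementaryLinearGroup (hn : 3 ≤ n) :
    commutator (elementaryLinearGroup n A) = ⊤ := by
  rw [eq_top_iff, commutator_eq_closure, elementaryLinearGroup,
    ← Subgroup.closure_closure_coe_preimage, Subgroup.closure_le]
  rintro ⟨_, _⟩ ⟨i, j, hij, c, rfl⟩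
  exact Subgroup.subset_closure (transvection_mem_commutatorSet hn hij c)

end ElementaryLinearGroup

section BlockMatrices

variable {m : Type*} [Fintype m] [DecidableEq m]

/-- The block-diagonal matrix `diag(s, t)`. -/
def diagBlockSL : Matrix.SpecialLinearGroup m A × Matrix.SpecialLinearGroup m A →*
    Matrix.SpecialLinearGroup (m ⊕ m) A where
  toFun p := ⟨fromBlocks (p.1 : Matrix m m A) 0 0 (p.2 : Matrix m m A), by
    rw [det_fromBlocks_zero₂₁, p.1.det_coe, p.2.det_coe, mul_one]⟩
  map_one' := by
    apply Subtype.ext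
    simp [Matrix.SpecialLinearGroup.coe_one]
  map_mul' p q := by
    apply Subtype.ext
    change _ = fromBlocks _ _ _ _ * fromBlocks _ _ _ _
    simp [fromBlocks_multiply]

/-- The block matrix with rows `(1, B)` and `(0, 1)`, as a homomorphism from the additive group of
matrices written multiplicatively. -/
def upperBlockSL : Multiplicative (Matrix m m A) →* Matrix.SpecialLinearGroup (m ⊕ m) A where
  toFun B := ⟨fromBlocks 1 B.toAdd 0 1, by simp⟩
  map_one' := by
    apply Subtype.ext
    simp [Matrix.SpecialLinearGroup.coe_one]
  map_mul' B C := by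
    apply Subtype.ext
    change _ = fromBlocks _ _ _ _ * fromBlocks _ _ _ _
    simp [fromBlocks_multiply, add_comm]

/-- The block matrix with rows `(1, 0)` and `(X, 1)`. -/
def lowerBlockSL (X : Matrix m m A) : Matrix.SpecialLinearGroup (m ⊕ m) A :=
  ⟨fromBlocks 1 0 X 1, by simp⟩

theorem coe_diagBlockSL (p : Matrix.SpecialLinearGroup m A × Matrix.SpecialLinearGroup m A) :
    (diagBlockSL p : Matrix (m ⊕ m) (m ⊕ m) A) =
      fromBlocks (p.1 : Matrix m m A) 0 0 (p.2 : Matrix m m A) := rfl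

theorem coe_upperBlockSL (B : Multiplicative (Matrix m m A)) :
    (upperBlockSL B : Matrix (m ⊕ m) (m ⊕ m) A) = fromBlocks 1 B.toAdd 0 1 := rfl

theorem coe_lowerBlockSL (X : Matrix m m A) :
    (lowerBlockSL X : Matrix (m ⊕ m) (m ⊕ m) A) = fromBlocks 1 0 X 1 := rfl

theorem coe_mul_coe_inv_mul (s : Matrix.SpecialLinearGroup m A) (B : Matrix m m A) :
    (s : Matrix m m A) * (((s⁻¹ : Matrix.SpecialLinearGroup m A) : Matrix m m A) * B) = B := by
  rw [← mul_assoc, ← Matrix.SpecialLinearGroup.coe_mul, mul_inv_cancel,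
    Matrix.SpecialLinearGroup.coe_one, one_mul]

theorem diagBlockSL_mul_upperBlockSL
    (p : Matrix.SpecialLinearGroup m A × Matrix.SpecialLinearGroup m A)
    (B : Multiplicative (Matrix m m A)) :
    diagBlockSL p * upperBlockSL B = upperBlockSL (.ofAdd ((p.1 : Matrix m m A) * B.toAdd *
      ((p.2⁻¹ : Matrix.SpecialLinearGroup m A) : Matrix m m A))) * diagBlockSL p := by
  apply Subtype.ext
  rw [Matrix.SpecialLinearGroup.coe_mul, Matrix.SpecialLinearGroup.coe_mul, coe_diagBlockSL,
    coe_upperBlockSL, coe_upperBlockSL, fromBlocks_multiply, fromBlocks_multiply, toAdd_ofAdd,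
    mul_assoc _ _ (p.2 : Matrix m m A), ← Matrix.SpecialLinearGroup.coe_mul, inv_mul_cancel,
    Matrix.SpecialLinearGroup.coe_one]
  simp

/-- The matrix `(0, 1; -1, 0)` in block form exchanges the two diagonal blocks. -/
theorem swap_mul_diagBlockSL (s t : Matrix.SpecialLinearGroup m A) :
    upperBlockSL (.ofAdd 1) * lowerBlockSL (-1) * upperBlockSL (.ofAdd 1) * diagBlockSL (s, t) =
      diagBlockSL (t, s) *
        (upperBlockSL (.ofAdd 1) * lowerBlockSL (-1) * upperBlockSL (.ofAdd 1)) := by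
  apply Subtype.ext
  simp [Matrix.SpecialLinearGroup.coe_mul, coe_diagBlockSL, coe_upperBlockSL, coe_lowerBlockSL,
    fromBlocks_multiply]

/-- If `t * X = X * s'` with `s' = s + B * X`, then conjugation by the lower unipotent matrix of `X`
takes the block upper triangular matrix with diagonal `(s', t - X * B)` and corner `B` to the one
with diagonal `(s, t)` and corner `B`. -/
theorem lowerBlockSL_mul_of_intertwines {s t s' t' : Matrix.SpecialLinearGroup m A}
    {X B : Matrix m m A} (hX : (t : Matrix m m A) * X = X * s')
    (hs : (s' : Matrix m m A) = s + B * X) (ht : (t' : Matrix m m A) = t - X * B) :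
    lowerBlockSL X * (diagBlockSL (s', t') * upperBlockSL
        (.ofAdd (((s'⁻¹ : Matrix.SpecialLinearGroup m A) : Matrix m m A) * B))) =
      diagBlockSL (s, t) * upperBlockSL
        (.ofAdd (((s⁻¹ : Matrix.SpecialLinearGroup m A) : Matrix m m A) * B)) *
          lowerBlockSL X := by
  apply Subtype.ext
  simp only [Matrix.SpecialLinearGroup.coe_mul, coe_diagBlockSL, coe_upperBlockSL,
    coe_lowerBlockSL, fromBlocks_multiply, toAdd_ofAdd, coe_mul_coe_inv_mul]
  simp [hX, ht, ← hs]

theorem upperBlockSL_single (i j : m) (c : A) :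
    upperBlockSL (.ofAdd (Matrix.single i j c)) = Matrix.SpecialLinearGroup.transvection
      (Sum.inl_ne_inr : (Sum.inl i : m ⊕ m) ≠ Sum.inr j) c := by
  apply Subtype.ext
  rw [coe_upperBlockSL]
  change _ = ((Matrix.SpecialLinearGroup.transvection _ c :
    Matrix.SpecialLinearGroup (m ⊕ m) A) : Matrix (m ⊕ m) (m ⊕ m) A)
  rw [Matrix.SpecialLinearGroup.transvection_coe]
  ext (a | a) (b | b) <;> simp [Matrix.single_apply, Matrix.one_apply]

theorem lowerBlockSL_single (i j : m) (c : A) :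
    lowerBlockSL (Matrix.single i j c) = Matrix.SpecialLinearGroup.transvection
      (Sum.inr_ne_inl : (Sum.inr i : m ⊕ m) ≠ Sum.inl j) c := by
  apply Subtype.ext
  rw [coe_lowerBlockSL]
  change _ = ((Matrix.SpecialLinearGroup.transvection _ c :
    Matrix.SpecialLinearGroup (m ⊕ m) A) : Matrix (m ⊕ m) (m ⊕ m) A)
  rw [Matrix.SpecialLinearGroup.transvection_coe]
  ext (a | a) (b | b) <;> simp [Matrix.single_apply, Matrix.one_apply]

theorem lowerBlockSL_add (X Y : Matrix m m A) :
    lowerBlockSL (X + Y) = lowerBlockSL X * lowerBlockSL Y := by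
  apply Subtype.ext
  simp [Matrix.SpecialLinearGroup.coe_mul, coe_lowerBlockSL, fromBlocks_multiply]

theorem diagBlockSL_transvection_one {i j : m} (hij : i ≠ j) (c : A) :
    diagBlockSL (Matrix.SpecialLinearGroup.transvection hij c, 1) =
      Matrix.SpecialLinearGroup.transvection (Sum.inl_injective.ne hij : (Sum.inl i : m ⊕ m) ≠ _)
        c := by
  apply Subtype.ext
  rw [coe_diagBlockSL, Matrix.SpecialLinearGroup.transvection_coe]
  change _ = ((Matrix.SpecialLinearGroup.transvection _ c :
    Matrix.SpecialLinearGroup (m ⊕ m) A) : Matrix (m ⊕ m) (m ⊕ m) A)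
  rw [Matrix.SpecialLinearGroup.transvection_coe]
  ext (a | a) (b | b) <;> simp [Matrix.single_apply, Matrix.one_apply]

end BlockMatrices

theorem matrix_eq_sum_single_fin_two (B : Matrix (Fin 2) (Fin 2) A) :
    B = Matrix.single 0 0 (B 0 0) + Matrix.single 0 1 (B 0 1) + Matrix.single 1 0 (B 1 0) +
      Matrix.single 1 1 (B 1 1) := by
  ext i j
  fin_cases i <;> fin_cases j <;> simp

end Blocks

/-! ### The corner `SL_2(A)` in `EL_n(A)` -/

section Corner

open Matrix

variable {A : Type*} [CommRing A] {n : ℕ} {μ : Type*} [Fintype μ] [DecidableEq μ]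

/-- The elements of `SL_4(A)`, written in `2 × 2` blocks, whose stabilization is elementary. -/
def elementaryPreimage (e : (Fin 2 ⊕ Fin 2) ⊕ μ ≃ Fin n) :
    Subgroup (Matrix.SpecialLinearGroup (Fin 2 ⊕ Fin 2) A) :=
  (elementaryLinearGroup n A).comap (stabilizeSL e)

variable (e : (Fin 2 ⊕ Fin 2) ⊕ μ ≃ Fin n)

/-- Stabilization `s ↦ diag(s, 1)`, restricted to a homomorphism into `EL_n(A)`. -/
def stabilizeElementary :
    elementaryPreimage (A := A) e →* elementaryLinearGroup n A :=
  (stabilizeSL e).subgroupComap (elementaryLinearGroup n A)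

theorem transvection_mem_elementaryPreimage {i j : Fin 2 ⊕ Fin 2} (hij : i ≠ j) (c : A) :
    Matrix.SpecialLinearGroup.transvection hij c ∈ elementaryPreimage e := by
  rw [elementaryPreimage, Subgroup.mem_comap,
    stabilizeSL_transvection e hij (e.injective.ne (Sum.inl_injective.ne hij))]
  exact transvection_mem_elementaryLinearGroup _ c

theorem upperBlockSL_mem (B : Multiplicative (Matrix (Fin 2) (Fin 2) A)) :
    upperBlockSL B ∈ elementaryPreimage e := by
  rw [← ofAdd_toAdd B, matrix_eq_sum_single_fin_two B.toAdd]
  simp only [ofAdd_add, map_mul, upperBlockSL_single]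
  exact mul_mem (mul_mem (mul_mem (transvection_mem_elementaryPreimage e _ _)
    (transvection_mem_elementaryPreimage e _ _)) (transvection_mem_elementaryPreimage e _ _))
    (transvection_mem_elementaryPreimage e _ _)

theorem lowerBlockSL_mem (X : Matrix (Fin 2) (Fin 2) A) :
    lowerBlockSL X ∈ elementaryPreimage e := by
  rw [matrix_eq_sum_single_fin_two X]
  simp only [lowerBlockSL_add, lowerBlockSL_single]
  exact mul_mem (mul_mem (mul_mem (transvection_mem_elementaryPreimage e _ _)
    (transvection_mem_elementaryPreimage e _ _)) (transvection_mem_elementaryPreimage e _ _))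
    (transvection_mem_elementaryPreimage e _ _)

theorem diagBlockSL_mem (h_elem : elementaryLinearGroup 2 A = ⊤)
    (p : Matrix.SpecialLinearGroup (Fin 2) A × Matrix.SpecialLinearGroup (Fin 2) A) :
    diagBlockSL p ∈ elementaryPreimage e := by
  have hfst : ∀ s : Matrix.SpecialLinearGroup (Fin 2) A,
      diagBlockSL (s, 1) ∈ elementaryPreimage e := by
    have h : elementaryLinearGroup 2 A ≤ (elementaryPreimage e).comap
        (diagBlockSL.comp (MonoidHom.inl _ _)) := by
      rw [elementaryLinearGroup, Subgroup.closure_le]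
      rintro _ ⟨i, j, hij, c, rfl⟩
      change diagBlockSL (Matrix.SpecialLinearGroup.transvection hij c, 1) ∈ elementaryPreimage e
      rw [diagBlockSL_transvection_one]
      exact transvection_mem_elementaryPreimage e _ _
    intro s
    exact h (h_elem ▸ Subgroup.mem_top s)
  -- The block `t` moves from the first to the second position under conjugation by `(0, 1; -1, 0)`.
  have hw : upperBlockSL (.ofAdd 1) * lowerBlockSL (-1) * upperBlockSL (.ofAdd 1) ∈
      elementaryPreimage (A := A) e :=
    mul_mem (mul_mem (upperBlockSL_mem e _) (lowerBlockSL_mem e _)) (upperBlockSL_mem e _)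
  have hsnd : diagBlockSL (1, p.2) ∈ elementaryPreimage e := by
    have h := mul_mem (mul_mem hw (hfst p.2)) (inv_mem hw)
    rwa [swap_mul_diagBlockSL, mul_inv_cancel_right] at h
  have hp : p = (p.1, 1) * (1, p.2) := by simp
  rw [hp, map_mul]
  exact mul_mem (hfst p.1) hsnd

/-- An upper unipotent block matrix is a product of four elementary matrices, each of which is a
commutator. -/
theorem commutatorLength_stabilize_upperBlockSL_le (hn : 3 ≤ n)
    (B : Multiplicative (Matrix (Fin 2) (Fin 2) A)) :
    commutatorLength (stabilizeElementary e ⟨upperBlockSL B, upperBlockSL_mem e B⟩) ≤ 4 := by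
  have h : ∀ i j c, commutatorLength
      (stabilizeElementary e ⟨upperBlockSL (.ofAdd (Matrix.single i j (c : A))),
        upperBlockSL_mem e _⟩) ≤ 1 := by
    intro i j c
    have he : stabilizeElementary e ⟨upperBlockSL (.ofAdd (Matrix.single i j (c : A))),
        upperBlockSL_mem e _⟩ = ⟨_, transvection_mem_elementaryLinearGroup
          (e.injective.ne (Sum.inl_injective.ne (Sum.inl_ne_inr (a := i) (b := j)))) c⟩ := by
      apply Subtype.ext
      change stabilizeSL e (upperBlockSL _) = _
      rw [upperBlockSL_single]
      exact stabilizeSL_transvection e _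
        (e.injective.ne (Sum.inl_injective.ne Sum.inl_ne_inr)) c
    rw [he]
    exact commutatorLength_le_one (transvection_mem_commutatorSet hn _ c)
  have hmul : ∀ B C : Matrix (Fin 2) (Fin 2) A,
      commutatorLength (stabilizeElementary e
        ⟨upperBlockSL (.ofAdd (B + C)), upperBlockSL_mem e _⟩) ≤
      commutatorLength (stabilizeElementary e
        ⟨upperBlockSL (.ofAdd B), upperBlockSL_mem e _⟩) +
      commutatorLength (stabilizeElementary e
        ⟨upperBlockSL (.ofAdd C), upperBlockSL_mem e _⟩) := by
    intro B C
    refine le_of_eq_of_le ?_ (commutatorLength_mul_le (commutator_elementaryLinearGroup hn) _ _)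
    rw [← map_mul]
    congr 2
    exact Subtype.ext (map_mul upperBlockSL _ _)
  obtain ⟨b, c, d, f, hB⟩ : ∃ b c d f : A, B = .ofAdd (Matrix.single 0 0 b +
      Matrix.single 0 1 c + Matrix.single 1 0 d + Matrix.single 1 1 f) :=
    ⟨_, _, _, _, congrArg Multiplicative.ofAdd (matrix_eq_sum_single_fin_two B.toAdd)⟩
  subst hB
  have h1 := hmul (Matrix.single 0 0 b + Matrix.single 0 1 c + Matrix.single 1 0 d)
    (Matrix.single 1 1 f)
  have h2 := hmul (Matrix.single 0 0 b + Matrix.single 0 1 c) (Matrix.single 1 0 d)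
  have h3 := hmul (Matrix.single 0 0 b) (Matrix.single 0 1 c)
  have h4 := h 0 0 b
  have h5 := h 0 1 c
  have h6 := h 1 0 d
  have h7 := h 1 1 f
  omega

/-- The block matrices inside `EL_n(A)` satisfy the hypotheses of
`powerClass_sq_eq_one_of_blocks`; the upper unipotent ones form the subgroup of bounded commutator
length normalized by the block-diagonal ones. -/
theorem powerClass_stabilize_diagBlockSL_sq (hn : 3 ≤ n)
    (h_elem : elementaryLinearGroup 2 A = ⊤) (s : Matrix.SpecialLinearGroup (Fin 2) A) :
    powerClass (commutator_elementaryLinearGroup hn)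
      (stabilizeElementary e ⟨diagBlockSL (s, 1), diagBlockSL_mem e h_elem _⟩) ^ 2 = 1 := by
  let J := stabilizeElementary (A := A) e
  let D : Matrix.SpecialLinearGroup (Fin 2) A × Matrix.SpecialLinearGroup (Fin 2) A →*
      elementaryLinearGroup n A :=
    J.comp (diagBlockSL.codRestrict _ (diagBlockSL_mem e h_elem))
  let U : Multiplicative (Matrix (Fin 2) (Fin 2) A) →* elementaryLinearGroup n A :=
    J.comp (upperBlockSL.codRestrict _ (upperBlockSL_mem e))
  let l : Matrix (Fin 2) (Fin 2) A → elementaryLinearGroup n A :=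
    fun X => J ⟨lowerBlockSL X, lowerBlockSL_mem e X⟩
  refine powerClass_sq_eq_one_of_blocks _ h_elem D (fun B => U (.ofAdd B)) l ?_ ?_ ?_ s
  · intro p B
    refine powerClass_mul_of_bounded _ U.range 4 ?_ ?_ ⟨_, rfl⟩
    · rintro _ ⟨B, rfl⟩
      exact commutatorLength_stabilize_upperBlockSL_le e hn B
    · rintro _ ⟨B, rfl⟩
      refine ⟨.ofAdd ((p.1 : Matrix (Fin 2) (Fin 2) A) * B.toAdd *
        ((p.2⁻¹ : Matrix.SpecialLinearGroup (Fin 2) A) : Matrix (Fin 2) (Fin 2) A)),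
        (mul_inv_eq_iff_eq_mul.2 ?_).symm⟩
      change J _ * J _ = J _ * J _
      rw [← map_mul, ← map_mul]
      exact congrArg J (Subtype.ext (diagBlockSL_mul_upperBlockSL p B))
  · refine ⟨U (.ofAdd 1) * l (-1) * U (.ofAdd 1), fun s t => mul_inv_eq_iff_eq_mul.2 ?_⟩
    change J _ * J _ * J _ * J _ = J _ * (J _ * J _ * J _)
    simp only [← map_mul]
    exact congrArg J (Subtype.ext (swap_mul_diagBlockSL s t))
  · intro s t s' t' X B hX hs ht
    refine ⟨((s'⁻¹ : Matrix.SpecialLinearGroup (Fin 2) A) : Matrix (Fin 2) (Fin 2) A) * B,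
      ((s⁻¹ : Matrix.SpecialLinearGroup (Fin 2) A) : Matrix (Fin 2) (Fin 2) A) * B,
      mul_inv_eq_iff_eq_mul.2 ?_⟩
    change J _ * (J _ * J _) = J _ * J _ * J _
    simp only [← map_mul]
    exact congrArg J (Subtype.ext (lowerBlockSL_mul_of_intertwines hX hs ht))

/-- The left upper corner of `SL_n(A)`, for `n = 2 + 2 + k`, is the image of the first of two
diagonal blocks. -/
theorem exists_equiv_cornerMatrix (hn : 4 ≤ n) :
    ∃ (k : ℕ) (e : (Fin 2 ⊕ Fin 2) ⊕ Fin k ≃ Fin n),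
      ∀ s : Matrix.SpecialLinearGroup (Fin 2) A,
        (stabilizeSL e (diagBlockSL (s, 1)) : Matrix (Fin n) (Fin n) A) =
          cornerMatrix n (s : Matrix (Fin 2) (Fin 2) A) := by
  obtain ⟨k, rfl⟩ : ∃ k, n = 2 + 2 + k := ⟨n - 4, by omega⟩
  refine ⟨k, (finSumFinEquiv.sumCongr (Equiv.refl _)).trans finSumFinEquiv, fun s => ?_⟩
  set e := (finSumFinEquiv.sumCongr (Equiv.refl (Fin k))).trans finSumFinEquiv with he
  rw [coe_stabilizeSL, coe_diagBlockSL]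
  ext a b
  obtain ⟨a, rfl⟩ := e.surjective a
  obtain ⟨b, rfl⟩ := e.surjective b
  rw [submatrix_apply, Equiv.symm_apply_apply, Equiv.symm_apply_apply, cornerMatrix]
  have h1 : ∀ x : Fin 2, (e (.inl (.inl x)) : ℕ) = x := fun _ => rfl
  have h2 : ∀ x : Fin 2, (e (.inl (.inr x)) : ℕ) = 2 + x := fun _ => rfl
  have h3 : ∀ x : Fin k, (e (.inr x) : ℕ) = 2 + 2 + x := fun _ => rfl
  rcases a with (a | a) | a <;> rcases b with (b | b) | b
  · rw [dif_pos ⟨(h1 a).trans_lt a.2, (h1 b).trans_lt b.2⟩]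
    rfl
  all_goals
    rw [dif_neg (by simp only [h1, h2, h3]; omega)]
    simp [e.apply_eq_iff_eq, Matrix.one_apply]

/-- The power class of a corner element `g` is only known to be `2`-torsion; since the stable
commutator length is homogeneous, `scl (g ^ 2) = 0` suffices. -/
theorem sclOfPerfect_eq_zero_of_mem_cornerSL2 (hn : 4 ≤ n)
    (hΓ : commutator (elementaryLinearGroup n A) = ⊤)
    (h_elem : elementaryLinearGroup 2 A = ⊤) {g : elementaryLinearGroup n A}
    (hg : g ∈ cornerSL2 n A) : sclOfPerfect hΓ g = 0 := by
  obtain ⟨s, hs⟩ := hg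
  obtain ⟨k, e, he⟩ := exists_equiv_cornerMatrix (A := A) hn
  have hgs : g = stabilizeElementary e ⟨diagBlockSL (s, 1), diagBlockSL_mem e h_elem _⟩ :=
    Subtype.ext (Subtype.ext (hs.trans (he s).symm))
  have h2 : powerClass hΓ (g ^ 2) = 1 := by
    rw [sq, powerClass_mul_of_commute hΓ (Commute.refl g), ← sq, hgs]
    exact powerClass_stabilize_diagBlockSL_sq e (by omega) h_elem s
  have h := sclOfPerfect_pow hΓ g two_ne_zero
  rw [sclOfPerfect_eq_zero_of_powerClass hΓ h2] at h
  push_cast at h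
  linarith

end Corner

/-! ### Bounded generation and the conclusion -/

theorem theorem1p3 {A : Type*} [CommRing A] (n : ℕ) (hn : 6 ≤ n)
    (h_elem : elementaryLinearGroup 2 A = ⊤)
    (h_gen : BoundedlyGenerates
      ![cornerSL2 n A, commutatorSet (elementaryLinearGroup n A)]) :
    (∀ ψ : elementaryLinearGroup n A → ℝ, IsQuasiHom ψ →
      ∃ C : ℝ, ∀ g : elementaryLinearGroup n A, |ψ g| ≤ C) ∧
    (∀ g : elementaryLinearGroup n A, HasStableCommutatorLength g 0) := by
  have hΓ : commutator (elementaryLinearGroup n A) = ⊤ :=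
    commutator_elementaryLinearGroup (by omega)
  obtain ⟨M, i, hM⟩ := h_gen
  have hF : ∀ j : Fin 2, ∀ x ∈ (![cornerSL2 n A, commutatorSet (elementaryLinearGroup n A)] :
      Fin 2 → Set (elementaryLinearGroup n A)) j, sclOfPerfect hΓ x ≤ 1 := by
    rw [Fin.forall_fin_two]
    refine ⟨fun x hx => ?_, fun x hx => ?_⟩
    · rw [sclOfPerfect_eq_zero_of_mem_cornerSL2 (by omega) hΓ h_elem hx]
      exact zero_le_one
    · exact (sclOfPerfect_le_commutatorLength hΓ x).trans
        (by exact_mod_cast commutatorLength_le_one hx)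
  have hscl : ∀ g, sclOfPerfect hΓ g = 0 := by
    refine sclOfPerfect_eq_zero_of_bounded hΓ fun g =>
      sclOfPerfect_le_of_mem_prod hΓ _ (fun F hF' => ?_) g (hM ▸ Set.mem_univ g)
    obtain ⟨m, rfl⟩ := (List.mem_ofFn' _ _).1 hF'
    exact hF (i m)
  refine ⟨fun ψ hψ => hψ.bounded_of_scl_eq_zero hΓ hscl, fun g => ⟨by simp [hΓ], ?_⟩⟩
  rw [← hscl g]
  exact tendsto_sclOfPerfect hΓ g
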